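/- Let $M$ be a nonempty compact connected smooth Riemannian manifold without boundary, of dimension $d\ge 1$, with Riemannian distance; $B(x,r)$ denotes an open ball. Let $f:M\to M$ be a $C^{1+\theta}$-expanding endomorphism for some $\theta\in(0,1]$: $f$ is $C^1$, its derivative is, in local charts, locally $\theta$-Hölder continuous, and there are $C>0$, $\lambda>1$ with $\|D_xf^k v\|\ge C\lambda^k\|v\|$ for all $k\ge 0$, $x\in M$, $v\in T_xM$. For $Y\subset M$ put $$E(f,Y)=\{z\in M:\ Y\cap\overline{\{f^k(z):k\ge 0\}}=\emptyset\}.$$ For $\epsilon>0$, a family $\mathcal T$ of $f$-induced $\epsilon$-tilings consists, for every $n\ge1$, of finitely many open connected sets $D_n^1,\dots,D_n^{k_n}\subset M$ (the $n$-atoms), pairwise disjoint, with $M=\bigcup_i\overline{D_n^i}$, such that for each $i$ there is $x\in D_n^i$ with $B(f^n(x),\epsilon/2)\subset f^n(D_n^i)\subset B(f^n(x),\epsilon)$. Let $\Omega$ be the set of pairs $(z,n)$ with $n\ge1$ and $z$ in some $n$-atom, and let $\psi(z,n)$ be the closure of the $n$-atom containing $z$. Call a positive integer $a_*$ admissible for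 $\mathcal T$ if for all $(z,n)\in\Omega$ and all integers $m>a_*$ there is $(z',n+m)\in\Omega$ with $\psi(z',n+m)\subset\psi(z,n)$. Given an admissible $a_*$, integers $a,b>a_*$ and a target $S\subset M$, in the $(a,b)$-game Bob and Alice alternately choose $\omega_1,\omega_1',\omega_2,\omega_2',\dots$ in $\Omega$, where $\omega_k=(z_k,n_k)$ is Bob's and $\omega_k'=(z_k',n_k')$ is Alice's choice, such that $\psi(\omega_k')\subset\psi(\omega_k)$ and $n_k'=n_k+a$ for $k\ge1$, and $\psi(\omega_k)\subset\psi(\omega_{k-1}')$ and $n_k=n_{k-1}'+b$ for $k\ge2$. Alice wins if $\bigcap_k(\psi(\omega_k)\cap\psi(\omega_k'))$ consists of exactly one point and this point lies in $S$. The set $S$ is $(a,b)$-winning if Alice has a strategy (always giving legal moves against legal play) that wins against every play of Bob; $S$ is winning, with respect to $a_*$, if there is $a>a_*$ such that $S$ is $(a,b)$-winning for every $b>a_*$. Then there is $\epsilon_0>0$, depending only on $M$ and $f$, such that for every $0<\epsilon<\epsilon_0$ and every family $\mathcal T$ of $f$-induced $\epsilon$-tilings of $M$: an admissible $a_*$ exists,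 and for every admissible $a_*$ and every countable $Y\subset M$ the set $E(f,Y)$ is winning for the modified Schmidt games induced by $f$ and played on $M$ with respect to $\mathcal T$. -/

import Mathlib

open Set Manifold Bundle
open scoped NNReal ContDiff

noncomputable section

/-- `f` is of class `C^{1+θ}`: it is `C^1` and, read in charts, its derivative is locally
`θ`-Hölder continuous. -/
def IsC1Holder {d : ℕ} {M : Type*} [TopologicalSpace M] [ChartedSpace (EuclideanSpace ℝ (Fin d)) M]
    (θ : ℝ≥0) (f : M → M) : Prop :=
  ContMDiff (𝓡 d) (𝓡 d) 1 f ∧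
  ∀ x : M, ∃ K : ℝ≥0, ∃ U ∈ nhds (extChartAt (𝓡 d) x x),
    HolderOnWith K θ (fderiv ℝ (writtenInExtChartAt (𝓡 d) (𝓡 d) x f)) U

/-- `f` is (uniformly) expanding for the given Riemannian metric: there are `C > 0` and `lam > 1`
with `‖D_x f^k v‖ ≥ C lam^k ‖v‖` for all `k`, `x` and tangent vectors `v` at `x`. -/
def IsExpanding {d : ℕ} {M : Type*} [TopologicalSpace M]
    [ChartedSpace (EuclideanSpace ℝ (Fin d)) M]
    [RiemannianBundle (fun x : M => TangentSpace (𝓡 d) x)] (f : M → M) : Prop :=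
  ∃ C lam : ℝ, 0 < C ∧ 1 < lam ∧ ∀ (k : ℕ) (x : M) (v : TangentSpace (𝓡 d) x),
    C * lam ^ k * ‖v‖ ≤ ‖mfderiv (𝓡 d) (𝓡 d) (f^[k]) x v‖

/-- `E(f, Y)`: the points whose forward orbit closure is disjoint from `Y`. -/
def nonAccumulating {M : Type*} [TopologicalSpace M] (f : M → M) (Y : Set M) : Set M :=
  {z | Y ∩ closure (range fun k : ℕ => f^[k] z) = ∅}

/-- A family of `f`-induced `ε`-tilings of `M`: for each level `n ≥ 1`, finitely many sets
`D n i`, `i < card n`. (Level `0` carries no condition and is never used.) -/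
structure InducedTiling {M : Type*} [MetricSpace M] (f : M → M) (ε : ℝ) where
  card : ℕ → ℕ
  D : (n : ℕ) → Fin (card n) → Set M
  isOpen : ∀ n, 1 ≤ n → ∀ i, IsOpen (D n i)
  isConnected : ∀ n, 1 ≤ n → ∀ i, IsConnected (D n i)
  image_bounds : ∀ n, 1 ≤ n → ∀ i, ∃ x ∈ D n i,
    Metric.ball (f^[n] x) (ε / 2) ⊆ f^[n] '' D n i ∧ f^[n] '' D n i ⊆ Metric.ball (f^[n] x) ε
  disjoint : ∀ n, 1 ≤ n → ∀ i j, i ≠ j → D n i ∩ D n j = ∅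
  cover : ∀ n, 1 ≤ n → ⋃ i, closure (D n i) = univ

namespace InducedTiling

variable {M : Type*} [MetricSpace M] {f : M → M} {ε : ℝ}

/-- The set `Ω` of pairs `(z, n)` with `n ≥ 1` and `z` in some atom of level `n`. -/
def Pos (T : InducedTiling f ε) : Set (M × ℕ) :=
  {p | 1 ≤ p.2 ∧ ∃ i, p.1 ∈ T.D p.2 i}

/-- The atom of level `n` containing `z`, for `p = (z, n) ∈ Ω`. -/
def atom (T : InducedTiling f ε) (p : M × ℕ) : Set M :=
  ⋃ i, ⋃ _ : p.1 ∈ T.D p.2 i, T.D p.2 i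

/-- `ψ(z, n)`, the closure of the atom of level `n` containing `z`. -/
def psi (T : InducedTiling f ε) (p : M × ℕ) : Set M := closure (T.atom p)

/-- The positive integer `aStar` is a gap threshold: inside every `ψ(z, n)` and for every
`m > aStar` one finds some `ψ(z', n + m)`. -/
def IsGap (T : InducedTiling f ε) (aStar : ℕ) : Prop :=
  0 < aStar ∧ ∀ p ∈ T.Pos, ∀ m, aStar < m →
    ∃ q ∈ T.Pos, q.2 = p.2 + m ∧ T.psi q ⊆ T.psi p

/-- Alice's `k`-th move (from `k = 0`) when she follows the strategy `s` against Bob's moves `p`: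
it is a function of Bob's moves up to turn `k`. -/
def response (s : List (M × ℕ) → M × ℕ) (p : ℕ → M × ℕ) (k : ℕ) : M × ℕ :=
  s (List.ofFn fun i : Fin (k + 1) => p i)

/-- Bob's `k`-th move `p k` is legal in the `(a, b)`-game in which Alice's moves are `q`. -/
def BobLegal (T : InducedTiling f ε) (b : ℕ) (p q : ℕ → M × ℕ) : ℕ → Prop
  | 0 => p 0 ∈ T.Pos
  | k + 1 => p (k + 1) ∈ T.Pos ∧ T.psi (p (k + 1)) ⊆ T.psi (q k) ∧
      (p (k + 1)).2 = (q k).2 + b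

/-- Alice's `k`-th move `q k` is legal in the `(a, b)`-game in which Bob's moves are `p`. -/
def AliceLegal (T : InducedTiling f ε) (a : ℕ) (p q : ℕ → M × ℕ) (k : ℕ) : Prop :=
  q k ∈ T.Pos ∧ T.psi (q k) ⊆ T.psi (p k) ∧ (q k).2 = (p k).2 + a

/-- `S` is `(a, b)`-winning: Alice has a strategy which answers legally as long as Bob
has played legally, and such that, if Bob plays legally forever, all the chosen closed atoms
intersect in exactly one point, which lies in `S`. -/
def IsWinningAB (T : InducedTiling f ε) (a b : ℕ) (S : Set M) : Prop :=
  ∃ s : List (M × ℕ) → M × ℕ, ∀ p : ℕ → M × ℕ,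
    (∀ k, (∀ j ≤ k, T.BobLegal b p (response s p) j) → T.AliceLegal a p (response s p) k) ∧
    ((∀ k, T.BobLegal b p (response s p) k) →
      ∃ z ∈ S, ⋂ k, (T.psi (p k) ∩ T.psi (response s p k)) = {z})

/-- `S` is winning (with respect to the threshold `aStar`): for some `a > aStar`, it is
`(a, b)`-winning for all `b > aStar`. -/
def IsWinning (T : InducedTiling f ε) (aStar : ℕ) (S : Set M) : Prop :=
  ∃ a, aStar < a ∧ ∀ b, aStar < b → T.IsWinningAB a b S

end InducedTiling

end

/-! Some iterate of `f` stretches tangent vectors at least twofold; lifting short paths through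
local inverses turns this into doubling of distances below a uniform scale `ρ`. A connected set
cannot jump over a gap in distances, so if `f^[m]` sends it into a small ball its diameter is at
most `β m`, where `β m → 0`. Hence `f^[n]` is injective on closed `n`-atoms, and each contains, `a`
levels deeper, two atoms with well separated `f^[n]`-images. Both cannot meet a set whose image is
small, so Alice can dodge such a set, with `a` independent of `b` and `Y`
(`InducedTiling.exists_forall_exists_psi_subset`).

On an `n`-atom she dodges the points visiting a small ball about `y` at times from `n - L - N` to `n
- L`. Their `f^[n]`-images are close together, because two visits at different times force `y` to
return exactly to itself (`exists_dist_lt_of_visits`). As `N` is arbitrary while `a` stays fixed,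
she can serve each point of `Y` at turns with bounded gaps and take windows long enough to cover all
times. -/

section

open Filter Topology MeasureTheory

/-! ### Local inverses of `C^1` maps. -/

section LocalInverse

variable {E H M : Type*} [NormedAddCommGroup E] [NormedSpace ℝ E] [FiniteDimensional ℝ E]
    [TopologicalSpace H] {I : ModelWithCorners ℝ E H} [I.Boundaryless] [TopologicalSpace M]
    [ChartedSpace H M] [IsManifold I 1 M]

/-- Inverse function theorem: a `C^1` self-map of a manifold with injective derivative at `x` has
a `C^1` local inverse there. -/
theorem exists_contMDiffOn_local_inverse {g : M → M} (hg : ContMDiff I I 1 g) (x : M)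
    (hx : Function.Injective (mfderiv I I g x)) :
    ∃ h : M → M, ContMDiffAt I I 1 h (g x) ∧ (∀ᶠ y in 𝓝 (g x), g (h y) = y) ∧
      ∀ᶠ u in 𝓝 x, h (g u) = u := by
  set φ := extChartAt I x with hφ
  set χ := extChartAt I (g x) with hχ
  set G : E → E := writtenInExtChartAt I I x g with hG
  have hGc : ContDiffAt ℝ 1 G (φ x) := by
    have := ((contMDiffAt_iff.1 (hg x)).2)
    rw [I.range_eq_univ, contDiffWithinAt_univ] at this
    exact this
  have hmd : MDifferentiableAt I I g x := (hg x).mdifferentiableAt one_ne_zero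
  have hfd : mfderiv I I g x = fderiv ℝ G (φ x) := by
    rw [hmd.mfderiv, I.range_eq_univ, fderivWithin_univ]
  have hinj : Function.Injective (fderiv ℝ G (φ x)) := by
    intro u v huv
    apply hx
    rw [hfd]
    exact huv
  let e : E ≃L[ℝ] E :=
    (LinearEquiv.ofInjectiveEndo (fderiv ℝ G (φ x) : _ →ₗ[ℝ] _) hinj).toContinuousLinearEquiv
  have he : HasFDerivAt G (e : _ →L[ℝ] _) (φ x) := by
    have h1 := hGc.differentiableAt one_ne_zero |>.hasFDerivAt
    have h2 : (e : E →L[ℝ] E) = fderiv ℝ G (φ x) := by ext v; rfl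
    rwa [h2]
  have hGx : G (φ x) = χ (g x) := by
    simp [hG, writtenInExtChartAt, hφ, hχ]
  set h₀ := hGc.localInverse he one_ne_zero with hh₀
  have h₀c : ContDiffAt ℝ 1 h₀ (χ (g x)) := by
    rw [← hGx]; exact hGc.to_localInverse he one_ne_zero
  have h₀x : h₀ (χ (g x)) = φ x := by
    rw [← hGx]; exact hGc.localInverse_apply_image he one_ne_zero
  have hst := hGc.hasStrictFDerivAt' he one_ne_zero
  have hr : ∀ᶠ w in 𝓝 (χ (g x)), G (h₀ w) = w := by
    rw [← hGx]; exact hst.eventually_right_inverse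
  have hl : ∀ᶠ w in 𝓝 (φ x), h₀ (G w) = w := hst.eventually_left_inverse
  have hχc : ContinuousAt χ (g x) := continuousAt_extChartAt (I := I) (g x)
  have hφc : ContinuousAt φ x := continuousAt_extChartAt (I := I) x
  have hχm : ContMDiffAt I 𝓘(ℝ, E) 1 χ (g x) :=
    contMDiffAt_extChartAt (I := I) (n := 1) (x := g x)
  have hφm : ContMDiffAt 𝓘(ℝ, E) I 1 φ.symm (φ x) := by
    have := contMDiffOn_extChartAt_symm (I := I) (n := 1) x
    exact this.contMDiffAt (extChartAt_target_mem_nhds (I := I) x)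
  have hm : ContMDiffAt I I 1 (φ.symm ∘ (h₀ ∘ χ)) (g x) := by
    have h1 : ContMDiffAt I 𝓘(ℝ, E) 1 (h₀ ∘ χ) (g x) := h₀c.contMDiffAt.comp (g x) hχm
    refine ContMDiffAt.comp (I' := 𝓘(ℝ, E)) (g x) ?_ h1
    rwa [Function.comp_apply, h₀x]
  have hmx : (φ.symm ∘ (h₀ ∘ χ)) (g x) = x := by
    simp [h₀x, hφ]
  refine ⟨φ.symm ∘ (h₀ ∘ χ), hm, ?_, ?_⟩
  · have e1 := hχc.eventually hr
    have e2 : ∀ᶠ y in 𝓝 (g x), y ∈ χ.source := extChartAt_source_mem_nhds (I := I) (g x)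
    have e3 : ∀ᶠ y in 𝓝 (g x), g ((φ.symm ∘ (h₀ ∘ χ)) y) ∈ χ.source := by
      have : ContinuousAt (g ∘ (φ.symm ∘ (h₀ ∘ χ))) (g x) :=
        (hg.continuous.continuousAt).comp hm.continuousAt
      apply this.eventually_mem
      simp only [Function.comp_apply] at hmx ⊢
      rw [hmx]
      exact extChartAt_source_mem_nhds (I := I) (g x)
    filter_upwards [e1, e2, e3] with y h1 h2 h3
    exact χ.injOn h3 h2 h1
  · have e1 := hφc.eventually hl
    have e2 : ∀ᶠ u in 𝓝 x, u ∈ φ.source := extChartAt_source_mem_nhds (I := I) x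
    filter_upwards [e1, e2] with u h1 h2
    have h3 : G (φ u) = χ (g u) := by
      simp only [hG, writtenInExtChartAt, Function.comp_apply]
      rw [φ.left_inv h2]
    simp only [Function.comp_apply]
    rw [← h3, h1, φ.left_inv h2]

end LocalInverse

/-! ### From expansion of vectors to local expansion of distances. -/

section Expanding

variable {d : ℕ} {M : Type*} [MetricSpace M]
    [ChartedSpace (EuclideanSpace ℝ (Fin d)) M]
    [RiemannianBundle (fun x : M => TangentSpace (𝓡 d) x)]

/-- If `g` expands tangent vectors by a factor `c`, and `g ∘ η = γ` then `η` is at least `c` times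
shorter than `γ`. -/
theorem mul_pathELength_le_of_comp {g : M → M} (hg : ContMDiff (𝓡 d) (𝓡 d) 1 g) {c : ℝ≥0}
    (hc : ∀ (x : M) (v : TangentSpace (𝓡 d) x), c * ‖v‖ ≤ ‖mfderiv (𝓡 d) (𝓡 d) g x v‖)
    {η γ : ℝ → M} (hη : ContMDiffOn 𝓘(ℝ, ℝ) (𝓡 d) 1 η (Icc 0 1))
    (h : EqOn (g ∘ η) γ (Icc 0 1)) :
    c * pathELength (𝓡 d) η 0 1 ≤ pathELength (𝓡 d) γ 0 1 := by
  rw [← pathELength_congr h, pathELength_eq_lintegral_mfderivWithin_Icc,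
    pathELength_eq_lintegral_mfderivWithin_Icc, ← lintegral_const_mul' _ _ ENNReal.coe_ne_top]
  refine setLIntegral_mono' measurableSet_Icc fun t ht => ?_
  have h1 : MDifferentiableWithinAt 𝓘(ℝ, ℝ) (𝓡 d) η (Icc 0 1) t :=
    (hη t ht).mdifferentiableWithinAt one_ne_zero
  have h2 : MDifferentiableAt (𝓡 d) (𝓡 d) g (η t) := (hg _).mdifferentiableAt one_ne_zero
  have h3 : UniqueMDiffWithinAt 𝓘(ℝ, ℝ) (Icc (0 : ℝ) 1) t :=
    (uniqueDiffOn_Icc zero_lt_one t ht).uniqueMDiffWithinAt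
  rw [mfderiv_comp_mfderivWithin t h2 h1 h3]
  have := hc (η t) (mfderivWithin 𝓘(ℝ, ℝ) (𝓡 d) η (Icc 0 1) t 1)
  rw [ContinuousLinearMap.comp_apply, ← ofReal_norm, ← ofReal_norm, ← ENNReal.ofReal_coe_nnreal]
  exact (ENNReal.ofReal_mul c.coe_nonneg).symm.trans_le (ENNReal.ofReal_le_ofReal this)

variable [IsRiemannianManifold (𝓡 d) M]

theorem exists_path_of_edist_lt {x y : M} {r : ENNReal} (hr : edist x y < r) :
    ∃ γ : ℝ → M, γ 0 = x ∧ γ 1 = y ∧ ContMDiffOn 𝓘(ℝ, ℝ) (𝓡 d) 1 γ (Icc 0 1) ∧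
      pathELength (𝓡 d) γ 0 1 < r := by
  rw [IsRiemannianManifold.out (I := 𝓡 d) x y] at hr
  exact exists_lt_of_riemannianEDist_lt hr

theorem edist_le_pathELength {γ : ℝ → M} (hγ : ContMDiffOn 𝓘(ℝ, ℝ) (𝓡 d) 1 γ (Icc 0 1))
    {t : ℝ} (ht : t ∈ Icc (0 : ℝ) 1) : edist (γ 0) (γ t) ≤ pathELength (𝓡 d) γ 0 1 := by
  rw [IsRiemannianManifold.out (I := 𝓡 d) (γ 0) (γ t)]
  exact (riemannianEDist_le_pathELength (hγ.mono (Icc_subset_Icc_right ht.2)) rfl rfl ht.1).trans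
    (pathELength_mono le_rfl ht.2)

/-- A `C^1` map that expands tangent vectors by a factor `c > 0` locally expands distances by the
same factor. -/
theorem eventually_mul_edist_le [IsManifold (𝓡 d) 1 M] {g : M → M} (hg : ContMDiff (𝓡 d) (𝓡 d) 1 g) {c : ℝ≥0}
    (hc0 : 0 < c)
    (hc : ∀ (x : M) (v : TangentSpace (𝓡 d) x), c * ‖v‖ ≤ ‖mfderiv (𝓡 d) (𝓡 d) g x v‖) (x : M) :
    ∃ U ∈ 𝓝 x, ∀ u ∈ U, ∀ v ∈ U, c * edist u v ≤ edist (g u) (g v) := by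
  have hinj : Function.Injective (mfderiv (𝓡 d) (𝓡 d) g x) := by
    rw [injective_iff_map_eq_zero]
    intro v hv
    have := hc x v
    rw [hv, norm_zero] at this
    have h1 : ‖v‖ ≤ 0 := le_of_mul_le_mul_left (by simpa using this) (NNReal.coe_pos.2 hc0)
    exact norm_le_zero_iff.1 h1
  obtain ⟨h, hh, hr, hl⟩ := exists_contMDiffOn_local_inverse hg x hinj
  have hev : ∀ᶠ y in 𝓝 (g x), ContMDiffAt (𝓡 d) (𝓡 d) 1 h y :=
    (contMDiffAt_iff_contMDiffAt_nhds (by simp)).1 hh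
  obtain ⟨R, hR, hW⟩ := EMetric.mem_nhds_iff.1 (hev.and hr)
  -- Image points within `R / 3` of `g x` are joined by a path shorter than `2R / 3`, which stays in
  -- the `R`-ball where `h` is a `C^1` right inverse, so `h ∘ γ` lifts it.
  have hR3 : 0 < R / 3 := ENNReal.div_pos hR.ne' (by simp)
  refine ⟨{u | h (g u) = u} ∩ g ⁻¹' Metric.eball (g x) (R / 3),
    inter_mem hl (hg.continuous.continuousAt.preimage_mem_nhds (Metric.eball_mem_nhds _ hR3)), ?_⟩
  rintro u ⟨hu, hu'⟩ v ⟨hv, hv'⟩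
  simp only [mem_preimage, Metric.mem_eball, mem_ofPred_eq] at hu hv hu' hv'
  have huv : edist (g u) (g v) < R / 3 + R / 3 :=
    (edist_triangle_right _ _ (g x)).trans_lt (ENNReal.add_lt_add hu' hv')
  refine le_of_forall_gt fun r hr' => ?_
  obtain ⟨γ, h0, h1, hγ, hlen⟩ := exists_path_of_edist_lt (d := d) (lt_min hr' huv)
  have hmem : ∀ t ∈ Icc (0 : ℝ) 1, γ t ∈ Metric.eball (g x) R := by
    intro t ht
    have h2 : edist (γ t) (g u) < R / 3 + R / 3 := by
      rw [edist_comm, ← h0]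
      exact (edist_le_pathELength hγ ht).trans_lt (hlen.trans_le (min_le_right _ _))
    rw [Metric.mem_eball]
    calc edist (γ t) (g x) ≤ edist (γ t) (g u) + edist (g u) (g x) := edist_triangle _ _ _
      _ < R / 3 + R / 3 + R / 3 := ENNReal.add_lt_add h2 hu'
      _ = R := ENNReal.add_thirds R
  have hη : ContMDiffOn 𝓘(ℝ, ℝ) (𝓡 d) 1 (h ∘ γ) (Icc 0 1) := fun t ht =>
    (hW (hmem t ht)).1.comp_contMDiffWithinAt t (hγ t ht)
  have hle := mul_pathELength_le_of_comp hg hc hη (fun t ht => (hW (hmem t ht)).2)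
  have huv' : edist u v ≤ pathELength (𝓡 d) (h ∘ γ) 0 1 := by
    have := edist_le_pathELength hη (right_mem_Icc.2 zero_le_one)
    simpa [h0, h1, hu, hv] using this
  exact ((mul_le_mul_right huv' _).trans hle).trans_lt (hlen.trans_le (min_le_left _ _))

end Expanding

/-! ### Backward contraction of connected sets, and returns near a point. -/

section ConnectedContraction

variable {M : Type*} [MetricSpace M]

/-- If `g` doubles distances below `ρ`, a connected set with small image is twice smaller than its
image. -/
theorem IsPreconnected.dist_le_half {g : M → M} {ρ : ℝ}
    (hg : ∀ u v, dist u v < ρ → 2 * dist u v ≤ dist (g u) (g v)) {A : Set M}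
    (hA : IsPreconnected A) {s : ℝ} (hs0 : 0 ≤ s) (hs : s / 2 < ρ)
    (hgA : ∀ u ∈ A, ∀ v ∈ A, dist (g u) (g v) ≤ s) {u v : M} (hu : u ∈ A) (hv : v ∈ A) :
    dist u v ≤ s / 2 := by
  by_contra! hlt
  -- These open sets cover `A` because `s / 2 < ρ`; a common point `w` would have its image farther
  -- than `s` from that of `u`.
  obtain ⟨w, hwA, hw1, hw2⟩ := hA {w | dist u w < ρ} {w | s / 2 < dist u w}
    (isOpen_lt (by fun_prop) (by fun_prop)) (isOpen_lt (by fun_prop) (by fun_prop))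
    (fun w _ => by
      rcases lt_or_ge (dist u w) ρ with h | h
      · exact Or.inl h
      · exact Or.inr (hs.trans_le h))
    ⟨u, hu, by change dist u u < ρ; rw [dist_self]; linarith⟩ ⟨v, hv, hlt⟩
  have h1 := hg u w hw1
  have h2 := hgA u hu w hwA
  change s / 2 < dist u w at hw2
  linarith

theorem IsPreconnected.dist_le_div_two_pow {g : M → M} (hgc : Continuous g) {ρ : ℝ}
    (hg : ∀ u v, dist u v < ρ → 2 * dist u v ≤ dist (g u) (g v)) {t : ℝ} (ht0 : 0 ≤ t)
    (ht : t < ρ) (k : ℕ) {A : Set M} (hA : IsPreconnected A)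
    (hgA : ∀ u ∈ A, ∀ v ∈ A, dist (g^[k] u) (g^[k] v) ≤ t) :
    ∀ u ∈ A, ∀ v ∈ A, dist u v ≤ t / 2 ^ k := by
  induction k generalizing A with
  | zero => simpa using hgA
  | succ k ih =>
    have h1 := ih (hA.image g hgc.continuousOn) (by
      rintro _ ⟨u, hu, rfl⟩ _ ⟨v, hv, rfl⟩
      simpa using hgA u hu v hv)
    intro u hu v hv
    have hp : (1 : ℝ) ≤ 2 ^ k := one_le_pow₀ (by norm_num)
    have h3 : t / 2 ^ k ≤ t := div_le_self ht0 hp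
    have := hA.dist_le_half hg (s := t / 2 ^ k) (by positivity) (by linarith)
      (fun u hu v hv => h1 _ (mem_image_of_mem g hu) _ (mem_image_of_mem g hv)) hu hv
    rwa [pow_succ, ← div_div]

variable [CompactSpace M]

theorem exists_forall_iterate_dist_lt {f : M → M} (hf : Continuous f) (N : ℕ) {r : ℝ}
    (hr : 0 < r) :
    ∃ δ > 0, ∀ m ≤ N, ∀ u v, dist u v < δ → dist (f^[m] u) (f^[m] v) < r := by
  have h : ∀ m, ∃ δ > 0, ∀ u v, dist u v < δ → dist (f^[m] u) (f^[m] v) < r := fun m =>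
    let ⟨δ, h0, h⟩ := Metric.uniformContinuous_iff.1
      (CompactSpace.uniformContinuous_of_continuous (hf.iterate m)) r hr
    ⟨δ, h0, fun _ _ h' => h h'⟩
  choose δ h0 h using h
  obtain ⟨m, -, hm⟩ := Finset.exists_min_image (Finset.range (N + 1)) δ ⟨0, by simp⟩
  exact ⟨δ m, h0 m, fun k hk u v huv =>
    h k u v (huv.trans_le (hm k (Finset.mem_range.2 (by omega))))⟩

/-- If an iterate of `f` locally doubles distances then connected sets that are mapped by `f^[m]`
into a small ball are small, uniformly in the set and with bound tending to `0` with `m`. -/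
theorem exists_dist_le_of_iterate_image_subset_ball {f : M → M} (hf : Continuous f) {N : ℕ}
    (hN : 0 < N) {ρ : ℝ} (hρ : 0 < ρ)
    (hexp : ∀ u v, dist u v < ρ → 2 * dist u v ≤ dist (f^[N] u) (f^[N] v)) :
    ∃ ε₀ > 0, ∃ β : ℕ → ℝ, Tendsto β atTop (𝓝 0) ∧ (∀ m, β m < ρ) ∧
      ∀ (m : ℕ) (A : Set M), IsPreconnected A → ∀ p, f^[m] '' A ⊆ Metric.ball p ε₀ →
        ∀ u ∈ A, ∀ v ∈ A, dist u v ≤ β m := by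
  obtain ⟨δ, hδ, h⟩ := exists_forall_iterate_dist_lt hf N (half_pos hρ)
  -- The time `m` is rounded up to a multiple of `N`; the at most `N` extra steps are controlled by
  -- uniform continuity through `δ`.
  refine ⟨δ / 2, half_pos hδ, fun m => ρ / 2 / 2 ^ (m / N + 1), ?_, ?_, ?_⟩
  · have h1 : Tendsto (fun m : ℕ => m / N + 1) atTop atTop :=
      (tendsto_add_atTop_nat 1).comp (Nat.tendsto_div_const_atTop hN.ne')
    exact (Tendsto.const_div_atTop (tendsto_pow_atTop_atTop_of_one_lt one_lt_two) (ρ / 2)).comp h1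
  · intro m
    have hp : (1 : ℝ) ≤ 2 ^ (m / N + 1) := one_le_pow₀ (by norm_num)
    have := div_le_self (half_pos hρ).le hp
    linarith
  · intro m A hA p hp
    refine hA.dist_le_div_two_pow (hf.iterate N) hexp (half_pos hρ).le (by linarith) (m / N + 1) ?_
    intro u hu v hv
    have hm : N * (m / N + 1) = (N - m % N) + m := by
      have h1 := Nat.div_add_mod m N
      have h2 := Nat.mod_lt m hN
      rw [mul_add]; omega
    rw [← Function.iterate_mul, hm, Function.iterate_add_apply, Function.iterate_add_apply]
    refine (h _ (Nat.sub_le _ _) _ _ ?_).le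
    have h1 := hp (mem_image_of_mem _ hu)
    have h2 := hp (mem_image_of_mem _ hv)
    rw [Metric.mem_ball] at h1 h2
    linarith [dist_triangle_right (f^[m] u) (f^[m] v) p]

/-- Times at which orbits of nearby points visit a small neighbourhood of `y` within a window of
length `N`: their images at the end are close together. -/
theorem exists_dist_lt_of_visits {f : M → M} (hf : Continuous f) {β : ℕ → ℝ}
    (hβ : Tendsto β atTop (𝓝 0)) {r : ℝ} (hr : 0 < r) (y : M) (N : ℕ) :
    ∃ (L : ℕ) (δ : ℝ), 0 < δ ∧ ∀ (n : ℕ) (A : Set M),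
      (∀ j ≤ n, ∀ u ∈ A, ∀ v ∈ A, dist (f^[j] u) (f^[j] v) ≤ β (n - j)) →
      ∀ u ∈ A, ∀ v ∈ A, ∀ i j, n ≤ i + L + N → i + L ≤ n → n ≤ j + L + N → j + L ≤ n →
        dist (f^[i] u) y < δ → dist (f^[j] v) y < δ → dist (f^[n] u) (f^[n] v) < r := by
  obtain ⟨η, hη, hret⟩ : ∃ η > 0, ∀ m ≤ N, f^[m] y ≠ y → η ≤ dist (f^[m] y) y := by
    classical
    let d' : ℕ → ℝ := fun m => if f^[m] y = y then 1 else dist (f^[m] y) y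
    obtain ⟨m, -, hm⟩ := Finset.exists_min_image (Finset.range (N + 1)) d' ⟨0, by simp⟩
    refine ⟨d' m, ?_, fun k hk hne => ?_⟩
    · by_cases h : f^[m] y = y
      · simp [d', h]
      · simp [d', h]
    · have := hm k (Finset.mem_range.2 (by omega))
      simpa [d', hne] using this
  obtain ⟨L, hL⟩ := eventually_atTop.1 (hβ.eventually (gt_mem_nhds (half_pos hη)))
  obtain ⟨δ₁, hδ₁, h₁⟩ := exists_forall_iterate_dist_lt hf (L + N) hr
  obtain ⟨δ₂, hδ₂, h₂⟩ := exists_forall_iterate_dist_lt hf N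
    (lt_min (half_pos hδ₁) (by positivity : 0 < η / 4))
  refine ⟨L, min δ₂ (min (δ₁ / 2) (η / 4)), by positivity, ?_⟩
  intro n A hA
  have key : ∀ u ∈ A, ∀ v ∈ A, ∀ i j, i ≤ j → n ≤ i + L + N → i + L ≤ n → n ≤ j + L + N →
      j + L ≤ n → dist (f^[i] u) y < min δ₂ (min (δ₁ / 2) (η / 4)) →
      dist (f^[j] v) y < min δ₂ (min (δ₁ / 2) (η / 4)) → dist (f^[n] u) (f^[n] v) < r := by
    intro u hu v hv i j hij hi1 hi2 hj1 hj2 hiu hjv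
    have hm : j - i ≤ N := by omega
    have e1 := h₂ (j - i) hm _ _ (hiu.trans_le (min_le_left _ _))
    rw [← Function.iterate_add_apply, Nat.sub_add_cancel hij] at e1
    have e2 := hjv.trans_le (min_le_right _ _)
    have e3 := e1.trans_le (min_le_left _ _)
    have e4 := e1.trans_le (min_le_right _ _)
    have e5 := e2.trans_le (min_le_left _ _)
    have e6 := e2.trans_le (min_le_right _ _)
    have e7 := hA j (by omega) u hu v hv
    have e8 := hL (n - j) (by omega)
    -- At an exact return both orbits are near `y` at time `j`, hence still close at time `n`.
    -- Otherwise `f^[j] u` is near `f^[j - i] y` and `f^[j] v` near `y`, so `η < η/4 + η/2 + η/4`,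
    -- the middle term coming from `n - j ≥ L`.
    by_cases hp : f^[j - i] y = y
    · have e9 : dist (f^[j] u) (f^[j] v) < δ₁ := by
        rw [hp] at e3
        linarith [dist_triangle_right (f^[j] u) (f^[j] v) y]
      have := h₁ (n - j) (by omega) _ _ e9
      rwa [← Function.iterate_add_apply, ← Function.iterate_add_apply,
        Nat.sub_add_cancel (by omega)] at this
    · have := hret _ hm hp
      have t1 := dist_triangle_left (f^[j - i] y) y (f^[j] u)
      have t2 := dist_triangle (f^[j] u) (f^[j] v) y
      linarith
  intro u hu v hv i j hi1 hi2 hj1 hj2 hiu hjv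
  rcases le_total i j with hij | hij
  · exact key u hu v hv i j hij hi1 hi2 hj1 hj2 hiu hjv
  · rw [dist_comm]
    exact key v hv u hu j i hij hj1 hj2 hi1 hi2 hjv hiu

end ConnectedContraction

/-! ### Geometry of the atoms. -/

namespace InducedTiling

variable {M : Type*} [MetricSpace M] {f : M → M} {ε : ℝ}

theorem exists_atom_eq (T : InducedTiling f ε) {p : M × ℕ} (hp : p ∈ T.Pos) :
    ∃ i, p.1 ∈ T.D p.2 i ∧ T.atom p = T.D p.2 i := by
  obtain ⟨hn, i, hi⟩ := hp
  refine ⟨i, hi, Subset.antisymm ?_ (subset_iUnion₂_of_subset i hi Subset.rfl)⟩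
  refine iUnion₂_subset fun j hj => ?_
  by_cases h : j = i
  · rw [h]
  · exact absurd (T.disjoint p.2 hn j i h) (nonempty_iff_ne_empty.1 ⟨p.1, hj, hi⟩)

theorem exists_pos_psi_eq (T : InducedTiling f ε) {n : ℕ} (hn : 1 ≤ n) (i : Fin (T.card n)) :
    ∃ q ∈ T.Pos, q.2 = n ∧ T.psi q = closure (T.D n i) := by
  obtain ⟨z, hz⟩ := (T.isConnected n hn i).nonempty
  have hp : (z, n) ∈ T.Pos := ⟨hn, i, hz⟩
  obtain ⟨j, hj, h⟩ := T.exists_atom_eq hp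
  have hij : j = i := by
    by_contra hne
    exact absurd (T.disjoint n hn j i hne) (nonempty_iff_ne_empty.1 ⟨z, hj, hz⟩)
  exact ⟨(z, n), hp, rfl, by rw [psi, h, hij]⟩

theorem psi_nonempty (T : InducedTiling f ε) {p : M × ℕ} (hp : p ∈ T.Pos) :
    (T.psi p).Nonempty := by
  obtain ⟨i, hi, h⟩ := T.exists_atom_eq hp
  exact ⟨p.1, subset_closure (h ▸ hi)⟩

/-- The atoms of a tiling contract with rate `β` under backward iteration of `f`. -/
def Contracts (T : InducedTiling f ε) (β : ℕ → ℝ) : Prop :=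
  ∀ n, 1 ≤ n → ∀ i, ∀ j ≤ n, ∀ u ∈ closure (T.D n i), ∀ v ∈ closure (T.D n i),
    dist (f^[j] u) (f^[j] v) ≤ β (n - j)

theorem contracts_of_image_subset_ball (T : InducedTiling f ε) (hf : Continuous f) {β : ℕ → ℝ}
    (h : ∀ (m : ℕ) (A : Set M), IsPreconnected A → ∀ p, f^[m] '' A ⊆ Metric.ball p ε →
      ∀ u ∈ A, ∀ v ∈ A, dist u v ≤ β m) : T.Contracts β := by
  intro n hn i j hj
  obtain ⟨x, -, -, hx⟩ := T.image_bounds n hn i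
  have h1 : ∀ u ∈ T.D n i, ∀ v ∈ T.D n i, dist (f^[j] u) (f^[j] v) ≤ β (n - j) := by
    intro u hu v hv
    refine h (n - j) (f^[j] '' T.D n i)
      ((T.isConnected n hn i).isPreconnected.image _ (hf.iterate j).continuousOn) (f^[n] x) ?_
      _ (mem_image_of_mem _ hu) _ (mem_image_of_mem _ hv)
    rwa [image_image, show (fun z => f^[n - j] (f^[j] z)) = f^[n] by
      rw [← Nat.sub_add_cancel hj, Function.iterate_add, Nat.add_sub_cancel]; rfl]
  have hfj := hf.iterate j
  have h2 : ∀ u ∈ T.D n i, ∀ v ∈ closure (T.D n i), dist (f^[j] u) (f^[j] v) ≤ β (n - j) :=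
    fun u hu => closure_minimal (s := T.D n i) (t := {v | dist (f^[j] u) (f^[j] v) ≤ β (n - j)})
      (h1 u hu) (isClosed_le (by fun_prop) continuous_const)
  intro u hu v hv
  exact closure_minimal (s := T.D n i) (t := {u | dist (f^[j] u) (f^[j] v) ≤ β (n - j)})
    (fun u hu => h2 u hu v hv) (isClosed_le (by fun_prop) continuous_const) hu

theorem Contracts.dist_le_of_mem_psi {T : InducedTiling f ε} {β : ℕ → ℝ} (hT : T.Contracts β)
    {p : M × ℕ} (hp : p ∈ T.Pos) {j : ℕ} (hj : j ≤ p.2) {u v : M} (hu : u ∈ T.psi p)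
    (hv : v ∈ T.psi p) : dist (f^[j] u) (f^[j] v) ≤ β (p.2 - j) := by
  obtain ⟨i, -, h⟩ := T.exists_atom_eq hp
  rw [psi, h] at hu hv
  exact hT p.2 hp.1 i j hj u hu v hv

/-- All intermediate images of a closed atom have diameter below `ρ`, the injectivity scale of `f`,
so equality is pulled back one step at a time. -/
theorem Contracts.eq_of_iterate_eq {T : InducedTiling f ε} {β : ℕ → ℝ} (hT : T.Contracts β)
    {ρ : ℝ} (hβ : ∀ m, β m < ρ) (hinj : ∀ u v, dist u v < ρ → f u = f v → u = v) {n : ℕ}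
    (hn : 1 ≤ n) {i : Fin (T.card n)} {u v : M} (hu : u ∈ closure (T.D n i))
    (hv : v ∈ closure (T.D n i)) (huv : f^[n] u = f^[n] v) : u = v := by
  have h : ∀ k ≤ n, f^[n - k] u = f^[n - k] v := by
    intro k hk
    induction k with
    | zero => exact huv
    | succ k ih =>
      refine hinj _ _ ((hT n hn i _ (Nat.sub_le _ _) u hu v hv).trans_lt (hβ _)) ?_
      rw [← Function.iterate_succ_apply' f, ← Function.iterate_succ_apply' f,
        show (n - (k + 1)).succ = n - k by omega]
      exact ih (by omega)
  simpa using h n le_rfl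

/-- A point well inside an atom belongs to a much finer closed atom inside the given one. -/
theorem Contracts.exists_closure_subset {T : InducedTiling f ε} {β : ℕ → ℝ} (hT : T.Contracts β)
    {ρ : ℝ} (hβ : ∀ m, β m < ρ) (hinj : ∀ u v, dist u v < ρ → f u = f v → u = v) {n : ℕ}
    (hn : 1 ≤ n) (i : Fin (T.card n)) {w : M} (hw : w ∈ T.D n i) {m : ℕ}
    (hb : Metric.closedBall (f^[n] w) (β m) ⊆ f^[n] '' T.D n i) :
    ∃ i', closure (T.D (n + m) i') ⊆ T.D n i ∧
      ∀ z ∈ closure (T.D (n + m) i'), dist (f^[n] z) (f^[n] w) ≤ β m := by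
  have hnm : 1 ≤ n + m := by omega
  obtain ⟨i', hi'⟩ := mem_iUnion.1 ((T.cover (n + m) hnm).symm ▸ mem_univ w)
  have hd : ∀ z ∈ closure (T.D (n + m) i'), dist (f^[n] z) (f^[n] w) ≤ β m := by
    intro z hz
    simpa using hT (n + m) hnm i' n (by omega) z hz w hi'
  refine ⟨i', ?_, hd⟩
  -- A connected set meeting the open atom stays in it unless it meets the boundary, which
  -- injectivity of `f^[n]` on the closed atom rules out.
  refine (T.isConnected (n + m) hnm i').isPreconnected.closure.subset_of_closure_inter_subset
    (T.isOpen n hn i) ⟨w, hi', hw⟩ ?_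
  rintro v ⟨hv, hv'⟩
  obtain ⟨v', hv'D, he⟩ := hb (hd v hv')
  rwa [← hT.eq_of_iterate_eq hβ hinj hn (subset_closure hv'D) hv he]

/-- Inside every closed atom there is a finer one, finer by a uniform number of levels, that avoids
a prescribed set which looks small at the scale of the atom. -/
theorem exists_forall_exists_psi_subset {β : ℕ → ℝ}
    (hβ0 : Tendsto β atTop (𝓝 0)) {ρ : ℝ} (hβ : ∀ m, β m < ρ)
    (hinj : ∀ u v, dist u v < ρ → f u = f v → u = v) (hε : 0 < ε) {κ : ℝ} (hκ : 0 < κ)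
    (hsep : ∀ c : M, ∃ w ∈ Metric.ball c (ε / 4), κ ≤ dist w c) :
    ∃ a₀ : ℕ, ∀ a, a₀ ≤ a → ∀ T : InducedTiling f ε, T.Contracts β → ∀ p ∈ T.Pos, ∀ Z : Set M,
      (∀ u ∈ T.psi p ∩ Z, ∀ v ∈ T.psi p ∩ Z, dist (f^[p.2] u) (f^[p.2] v) < κ / 4) →
      ∃ q ∈ T.Pos, q.2 = p.2 + a ∧ T.psi q ⊆ T.psi p ∧ Disjoint (T.psi q) Z := by
  obtain ⟨a₀, ha₀⟩ := eventually_atTop.1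
    (hβ0.eventually (gt_mem_nhds (lt_min (by positivity : 0 < ε / 4) (by positivity : 0 < κ / 4))))
  refine ⟨a₀, fun a ha T hT p hp Z hZ => ?_⟩
  have hβ1 := (ha₀ a ha).trans_le (min_le_left _ _)
  have hβ2 := (ha₀ a ha).trans_le (min_le_right _ _)
  obtain ⟨i, -, hatom⟩ := T.exists_atom_eq hp
  have hn := hp.1
  obtain ⟨x, hx, hx', -⟩ := T.image_bounds p.2 hn i
  have hfine : ∀ c ∈ Metric.ball (f^[p.2] x) (ε / 4), ∃ q ∈ T.Pos, q.2 = p.2 + a ∧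
      T.psi q ⊆ T.psi p ∧ ∀ z ∈ T.psi q, dist (f^[p.2] z) c < κ / 4 := by
    intro c hc
    obtain ⟨w, hw, rfl⟩ := hx' (Metric.ball_subset_ball (by linarith) hc)
    obtain ⟨i', h1, h2⟩ := hT.exists_closure_subset hβ hinj hn i hw (m := a) (by
      refine Subset.trans (fun z hz => ?_) hx'
      rw [Metric.mem_ball] at hc ⊢
      rw [Metric.mem_closedBall] at hz
      linarith [dist_triangle z (f^[p.2] w) (f^[p.2] x)])
    obtain ⟨q, hq, hq2, hqψ⟩ := T.exists_pos_psi_eq (n := p.2 + a) (by omega) i'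
    refine ⟨q, hq, hq2, ?_, fun z hz => ?_⟩
    · rw [hqψ, psi, hatom]
      exact h1.trans subset_closure
    · exact (h2 z (hqψ ▸ hz)).trans_lt hβ2
  obtain ⟨w, hw, hκw⟩ := hsep (f^[p.2] x)
  obtain ⟨q₁, hq₁, hl₁, hs₁, hd₁⟩ := hfine _ (Metric.mem_ball_self (by positivity))
  obtain ⟨q₂, hq₂, hl₂, hs₂, hd₂⟩ := hfine _ hw
  by_cases h1 : Disjoint (T.psi q₁) Z
  · exact ⟨q₁, hq₁, hl₁, hs₁, h1⟩
  by_cases h2 : Disjoint (T.psi q₂) Z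
  · exact ⟨q₂, hq₂, hl₂, hs₂, h2⟩
  -- If both candidates meet `Z`, their centres are less than `3κ/4` apart.
  obtain ⟨z₁, hz₁, hz₁'⟩ := not_disjoint_iff.1 h1
  obtain ⟨z₂, hz₂, hz₂'⟩ := not_disjoint_iff.1 h2
  have e1 := hd₁ z₁ hz₁
  have e2 := hd₂ z₂ hz₂
  have e3 := hZ z₁ ⟨hs₁ hz₁, hz₁'⟩ z₂ ⟨hs₂ hz₂, hz₂'⟩
  have t1 := dist_triangle_left w (f^[p.2] x) (f^[p.2] z₂)
  have t2 := dist_triangle_left (f^[p.2] z₂) (f^[p.2] x) (f^[p.2] z₁)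
  linarith

end InducedTiling

/-! ### Scheduling the targets and Alice's strategy. -/

/-- There is a sequence of naturals in which every natural occurs with bounded gaps. -/
theorem exists_seq_syndetic :
    ∃ (c P : ℕ → ℕ), ∀ i k₀, ∃ k, k₀ ≤ k ∧ k ≤ k₀ + P i ∧ c k = i := by
  -- Valuation exactly `i` occurs at the odd multiples of `2 ^ i`; the shift by one avoids the
  -- valuation of `0`.
  refine ⟨fun k => padicValNat 2 (k + 1), fun i => 2 ^ (i + 2), fun i k₀ => ?_⟩
  have hpos : 0 < 2 ^ i := by positivity
  have h1 := Nat.div_add_mod k₀ (2 ^ (i + 1))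
  have h2 := Nat.mod_lt k₀ (show 0 < 2 ^ (i + 1) by positivity)
  have e1 : 2 ^ (i + 1) = 2 * 2 ^ i := by ring
  have e2 : 2 ^ (i + 2) = 4 * 2 ^ i := by ring
  set t := k₀ / 2 ^ (i + 1)
  have e3 : 2 ^ i * (2 * (t + 1) + 1) = 2 ^ (i + 1) * t + 3 * 2 ^ i := by ring
  refine ⟨2 ^ i * (2 * (t + 1) + 1) - 1, by omega, by simp only []; omega, ?_⟩
  have h4 : 2 ^ i * (2 * (t + 1) + 1) - 1 + 1 = 2 ^ i * (2 * (t + 1) + 1) := by omega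
  simp only [h4]
  rw [padicValNat.mul (by positivity) (by positivity), padicValNat.prime_pow,
    padicValNat.eq_zero_of_not_dvd (by omega), add_zero]

namespace InducedTiling

variable {M : Type*} [MetricSpace M] {f : M → M} {ε : ℝ}

/-- The strategy that applies `mv` to the turn number, the first and the last move. -/
theorem exists_strategy {M : Type*} [Nonempty M] (mv : ℕ → M × ℕ → M × ℕ → M × ℕ) :
    ∃ s : List (M × ℕ) → M × ℕ, ∀ p k, response s p k = mv k (p 0) (p k) := by
  obtain ⟨x₀⟩ := ‹Nonempty M›
  refine ⟨fun l => mv (l.length - 1) (l[0]?.getD (x₀, 0)) (l[l.length - 1]?.getD (x₀, 0)),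
    fun p k => ?_⟩
  simp only [response, List.length_ofFn, Nat.add_sub_cancel, List.getElem?_ofFn]
  simp

theorem snd_eq_of_legal {T : InducedTiling f ε} {a b : ℕ} {p q : ℕ → M × ℕ}
    (hp : ∀ k, T.BobLegal b p q k) (hq : ∀ k, T.AliceLegal a p q k) (k : ℕ) :
    (p k).2 = (p 0).2 + k * (a + b) := by
  induction k with
  | zero => simp
  | succ k ih =>
    rw [(hp (k + 1)).2.2, (hq k).2.2, ih]
    ring

theorem BobLegal.mem_pos {T : InducedTiling f ε} {b : ℕ} {p q : ℕ → M × ℕ} {k : ℕ}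
    (h : T.BobLegal b p q k) : p k ∈ T.Pos := by
  cases k with
  | zero => exact h
  | succ k => exact h.1

/-- The outcome of a legal play is a single point. -/
theorem Contracts.exists_iInter_eq_singleton [CompactSpace M] {T : InducedTiling f ε}
    {β : ℕ → ℝ} (hT : T.Contracts β) (hβ0 : Tendsto β atTop (𝓝 0)) {a b : ℕ} (hab : 0 < a + b)
    {p q : ℕ → M × ℕ} (hp : ∀ k, T.BobLegal b p q k) (hq : ∀ k, T.AliceLegal a p q k) :
    ∃ z, ⋂ k, (T.psi (p k) ∩ T.psi (q k)) = {z} := by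
  have hF : ∀ k, T.psi (p k) ∩ T.psi (q k) = T.psi (q k) := fun k =>
    inter_eq_right.2 (hq k).2.1
  simp only [hF]
  obtain ⟨z, hz⟩ := IsCompact.nonempty_iInter_of_sequence_nonempty_isCompact_isClosed
    (fun k => T.psi (q k)) (fun k => (hq (k + 1)).2.1.trans (hp (k + 1)).2.1)
    (fun k => T.psi_nonempty (hq k).1) isClosed_closure.isCompact (fun k => isClosed_closure)
  refine ⟨z, Subset.antisymm (fun w hw => ?_) (singleton_subset_iff.2 hz)⟩
  rw [mem_iInter] at hw hz
  have hlev : Tendsto (fun k => (p k).2) atTop atTop := by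
    refine tendsto_atTop_mono (fun k => ?_) tendsto_id
    rw [snd_eq_of_legal hp hq k]
    exact le_add_left (Nat.le_mul_of_pos_right k hab)
  have hle : dist w z ≤ 0 := ge_of_tendsto' (hβ0.comp hlev) fun k => by
    simpa using hT.dist_le_of_mem_psi (hp k).mem_pos (Nat.zero_le _) ((hq k).2.1 (hw k))
      ((hq k).2.1 (hz k))
  exact dist_le_zero.1 hle

/-- Alice wins if she can always avoid sets that look small at the scale of the current atom. -/
theorem Contracts.isWinningAB_nonAccumulating [CompactSpace M] [Nonempty M] (hf : Continuous f)
    {T : InducedTiling f ε} {β : ℕ → ℝ} (hT : T.Contracts β) (hβ0 : Tendsto β atTop (𝓝 0))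
    {r : ℝ} (hr : 0 < r) {a b : ℕ} (hab : 0 < a + b)
    (hmove : ∀ p ∈ T.Pos, ∀ Z : Set M,
      (∀ u ∈ T.psi p ∩ Z, ∀ v ∈ T.psi p ∩ Z, dist (f^[p.2] u) (f^[p.2] v) < r) →
      ∃ q ∈ T.Pos, q.2 = p.2 + a ∧ T.psi q ⊆ T.psi p ∧ Disjoint (T.psi q) Z)
    {Y : Set M} (hY : Y.Countable) : T.IsWinningAB a b (nonAccumulating f Y) := by
  obtain ⟨e, he⟩ := countable_iff_exists_subset_range.1 hY
  obtain ⟨c, P, hcP⟩ := exists_seq_syndetic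
  choose L δ hδ hvis using exists_dist_lt_of_visits hf hβ0 hr
  let bad : M → ℕ → M × ℕ → Set M := fun y N p =>
    {z | ∃ j, p.2 ≤ j + L y N + N ∧ j + L y N ≤ p.2 ∧ dist (f^[j] z) y < δ y N}
  have hmv : ∀ (y : M) (N : ℕ) (p : M × ℕ), ∃ q, p ∈ T.Pos → q ∈ T.Pos ∧ q.2 = p.2 + a ∧
      T.psi q ⊆ T.psi p ∧ Disjoint (T.psi q) (bad y N p) := by
    intro y N p
    by_cases hp : p ∈ T.Pos
    · obtain ⟨q, hq, h⟩ := hmove p hp (bad y N p) (by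
        rintro u ⟨hu, i, hi1, hi2, hi3⟩ v ⟨hv, j, hj1, hj2, hj3⟩
        exact hvis y N p.2 (T.psi p) (fun j hj u hu v hv => hT.dist_le_of_mem_psi hp hj hu hv)
          u hu v hv i j hi1 hi2 hj1 hj2 hi3 hj3)
      exact ⟨q, fun _ => ⟨hq, h⟩⟩
    · exact ⟨p, fun h => absurd h hp⟩
  choose mv hmv using hmv
  -- The window spans the gap between turns serving target `i`, plus Bob's initial level `n`; hence
  -- the strategy remembers his first move.
  let N : ℕ → ℕ → ℕ := fun i n => n + (a + b) + P i * (a + b)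
  obtain ⟨s, hs⟩ := exists_strategy fun k p₀ p => mv (e (c k)) (N (c k) p₀.2) p
  refine ⟨s, fun p => ⟨fun k hk => ?_, fun hp => ?_⟩⟩
  · obtain ⟨h1, h2, h3, -⟩ := hmv (e (c k)) (N (c k) (p 0).2) (p k) (hk k le_rfl).mem_pos
    rw [AliceLegal, hs]
    exact ⟨h1, h3, h2⟩
  have hq : ∀ k, T.AliceLegal a p (response s p) k := by
    intro k
    obtain ⟨h1, h2, h3, -⟩ := hmv (e (c k)) (N (c k) (p 0).2) (p k) (hp k).mem_pos
    rw [AliceLegal, hs]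
    exact ⟨h1, h3, h2⟩
  obtain ⟨z, hz⟩ := hT.exists_iInter_eq_singleton hβ0 hab hp hq
  refine ⟨z, ?_, hz⟩
  have hzk : ∀ k, z ∈ T.psi (response s p k) := fun k =>
    (mem_iInter.1 (hz.symm ▸ mem_singleton z : z ∈ ⋂ k, (T.psi (p k) ∩ T.psi (response s p k)))
      k).2
  refine eq_empty_iff_forall_notMem.2 ?_
  rintro y ⟨hyY, hy⟩
  obtain ⟨i, rfl⟩ := he hyY
  obtain ⟨_, ⟨j, rfl⟩, hj⟩ := Metric.mem_closure_iff.1 hy _ (hδ (e i) (N i (p 0).2))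
  set l := L (e i) (N i (p 0).2) with hl
  -- This is a turn serving `i` whose level lies between `j + l` and `j + l + N`, so that time `j`
  -- falls in its window.
  obtain ⟨k, hk1, hk2, rfl⟩ := hcP i ((j + l) / (a + b) + 1)
  have hdis := (hmv (e (c k)) (N (c k) (p 0).2) (p k) (hp k).mem_pos).2.2.2
  have hzk' := hzk k
  rw [hs] at hzk'
  refine disjoint_left.1 hdis hzk' ⟨j, ?_, ?_, by rwa [dist_comm]⟩
  · rw [snd_eq_of_legal hp hq k, ← hl]
    have h1 := Nat.mul_le_mul_right (a + b) hk2
    have h2 := Nat.div_mul_le_self (j + l) (a + b)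
    simp only [add_mul, one_mul, N] at h1 h2 ⊢
    omega
  · rw [snd_eq_of_legal hp hq k, ← hl]
    have h1 := Nat.mul_le_mul_right (a + b) hk1
    have h2 := Nat.lt_div_mul_add (a := j + l) hab
    simp only [add_mul, one_mul] at h1 h2 ⊢
    omega

end InducedTiling

/-! ### Global properties of `M` and the uniform doubling scale. -/

section RiemannianManifold

variable {d : ℕ} {M : Type*} [MetricSpace M] [ChartedSpace (EuclideanSpace ℝ (Fin d)) M]

theorem nontrivial_of_chartedSpace [Nonempty M] (hd : 0 < d) : Nontrivial M := by
  obtain ⟨x⟩ := ‹Nonempty M›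
  by_contra hM
  rw [not_nontrivial_iff_subsingleton] at hM
  have : Nonempty (Fin d) := ⟨⟨0, hd⟩⟩
  set φ := extChartAt (𝓡 d) x
  have h1 : φ.target ∈ 𝓝 (φ x) := extChartAt_target_mem_nhds (I := 𝓡 d) x
  have h2 : φ.target ⊆ {φ x} := by
    intro w hw
    rw [← φ.right_inv hw, Subsingleton.elim (φ.symm w) x]
    rfl
  have h3 : ({φ x} : Set (EuclideanSpace ℝ (Fin d))) ∈ 𝓝 (φ x) := mem_of_superset h1 h2
  exact (NeBot.ne (inferInstance : NeBot (𝓝[≠] (φ x)))) (isOpen_singleton_iff_punctured_nhds _ |>.1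
    (isOpen_singleton_iff_nhds_eq_pure _ |>.2
      (le_antisymm (le_pure_iff.2 h3) (pure_le_nhds _))))

/-- A metric space has finite distances, so any two points are joined by a path of finite length. -/
theorem IsRiemannianManifold.preconnectedSpace
    [RiemannianBundle (fun x : M => TangentSpace (𝓡 d) x)] (_ : IsRiemannianManifold (𝓡 d) M) :
    PreconnectedSpace M := by
  refine ⟨isPreconnected_of_forall_pair fun x _ y _ => ?_⟩
  obtain ⟨γ, h0, h1, hγ, -⟩ := exists_path_of_edist_lt (d := d) (edist_lt_top x y)
  exact ⟨γ '' Icc 0 1, subset_univ _, ⟨0, by simp, h0⟩, ⟨1, by simp, h1⟩,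
    isPreconnected_Icc.image γ hγ.continuousOn⟩

end RiemannianManifold

/-- Provides the second, separated centre in Alice's dodge: one of two fixed points is far from `c`,
and the distance to `c` takes all intermediate values. -/
theorem exists_forall_exists_dist_eq {M : Type*} [MetricSpace M] [PreconnectedSpace M]
    [Nontrivial M] : ∃ r > 0, ∀ s ∈ Icc 0 r, ∀ c : M, ∃ w, dist w c = s := by
  obtain ⟨x, y, hxy⟩ := exists_pair_ne M
  refine ⟨dist x y / 2, half_pos (dist_pos.2 hxy), fun s hs c => ?_⟩
  obtain ⟨w, hw⟩ : ∃ w, dist x y / 2 ≤ dist w c := by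
    by_contra! h
    linarith [h x, h y, dist_triangle_right x y c]
  exact mem_range_of_exists_le_of_exists_ge (f := fun w => dist w c) (by fun_prop)
    ⟨c, by simpa using hs.1⟩ ⟨w, hs.2.trans hw⟩

section Expanding

variable {d : ℕ} {M : Type*} [MetricSpace M] [CompactSpace M]
    [ChartedSpace (EuclideanSpace ℝ (Fin d)) M] [IsManifold (𝓡 d) 1 M]
    [RiemannianBundle (fun x : M => TangentSpace (𝓡 d) x)] [IsRiemannianManifold (𝓡 d) M]

/-- Some iterate of an expanding map doubles distances on a uniform scale. -/
theorem IsExpanding.exists_two_mul_dist_le {f : M → M} (hf : ContMDiff (𝓡 d) (𝓡 d) 1 f)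
    (hexp : IsExpanding (d := d) f) :
    ∃ N > 0, ∃ ρ > 0, ∀ u v, dist u v < ρ → 2 * dist u v ≤ dist (f^[N] u) (f^[N] v) := by
  obtain ⟨C, lam, hC, hlam, h⟩ := hexp
  obtain ⟨N₀, hN₀⟩ := pow_unbounded_of_one_lt (2 / C) hlam
  have hN : 2 ≤ C * lam ^ (N₀ + 1) := by
    rw [div_lt_iff₀ hC] at hN₀
    have h1 : lam ^ N₀ ≤ lam ^ (N₀ + 1) := pow_le_pow_right₀ hlam.le (Nat.le_succ _)
    nlinarith
  have hfi : ∀ k, ContMDiff (𝓡 d) (𝓡 d) 1 f^[k] := by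
    intro k
    induction k with
    | zero => exact contMDiff_id
    | succ k ih => rw [Function.iterate_succ]; exact ih.comp hf
  have hc : ∀ (x : M) (v : TangentSpace (𝓡 d) x),
      ((2 : ℝ≥0) : ℝ) * ‖v‖ ≤ ‖mfderiv (𝓡 d) (𝓡 d) (f^[N₀ + 1]) x v‖ := fun x v =>
    (mul_le_mul_of_nonneg_right hN (norm_nonneg v)).trans (h (N₀ + 1) x v)
  choose U hU hUe using eventually_mul_edist_le (hfi (N₀ + 1)) two_pos hc
  -- A Lebesgue number of the cover by local expansion neighbourhoods is the uniform scale.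
  obtain ⟨ρ, hρ, hleb⟩ := lebesgue_number_lemma_of_metric (isCompact_univ (X := M))
    (c := fun x => interior (U x)) (fun x => isOpen_interior)
    (fun x _ => mem_iUnion.2 ⟨x, mem_interior_iff_mem_nhds.2 (hU x)⟩)
  refine ⟨N₀ + 1, Nat.succ_pos _, ρ, hρ, fun u v huv => ?_⟩
  obtain ⟨x, hx⟩ := hleb u (mem_univ u)
  have h1 := hUe x u (interior_subset (hx (Metric.mem_ball_self hρ))) v
    (interior_subset (hx (by rwa [Metric.mem_ball, dist_comm])))
  rw [edist_nndist, edist_nndist, ← ENNReal.coe_mul, ENNReal.coe_le_coe] at h1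
  exact_mod_cast h1

end Expanding

end

theorem corollary5p2 {d : ℕ} (hd : 0 < d) {M : Type*} [MetricSpace M] [CompactSpace M] [Nonempty M]
    [ChartedSpace (EuclideanSpace ℝ (Fin d)) M] [IsManifold (𝓡 d) ∞ M]
    [RiemannianBundle (fun x : M => TangentSpace (𝓡 d) x)]
    [IsContMDiffRiemannianBundle (𝓡 d) ∞ (EuclideanSpace ℝ (Fin d))
      (fun x : M => TangentSpace (𝓡 d) x)]
    [IsRiemannianManifold (𝓡 d) M]
    (θ : ℝ≥0) (hθ : 0 < θ) (hθ1 : θ ≤ 1) (f : M → M)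
    (hf : IsC1Holder (d := d) θ f) (hexp : IsExpanding (d := d) f) :
    ∃ ε₀ : ℝ, 0 < ε₀ ∧ ∀ ε : ℝ, 0 < ε → ε < ε₀ → ∀ T : InducedTiling f ε,
      (∃ aStar : ℕ, T.IsGap aStar) ∧
      ∀ aStar : ℕ, T.IsGap aStar → ∀ Y : Set M, Y.Countable →
        T.IsWinning aStar (nonAccumulating f Y) := by
  have : IsManifold (𝓡 d) 1 M := IsManifold.of_le (n := ∞) (by simp)
  have : Nontrivial M := nontrivial_of_chartedSpace hd
  have : PreconnectedSpace M := IsRiemannianManifold.preconnectedSpace (d := d) ‹_›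
  have hfc : Continuous f := hf.1.continuous
  obtain ⟨N, hN, ρ, hρ, hdouble⟩ := hexp.exists_two_mul_dist_le hf.1
  have hinj : ∀ u v, dist u v < ρ → f u = f v → u = v := by
    intro u v huv he
    obtain ⟨k, rfl⟩ := Nat.exists_eq_succ_of_ne_zero hN.ne'
    have h1 := hdouble u v huv
    rw [Function.iterate_succ_apply, Function.iterate_succ_apply, he, dist_self] at h1
    exact dist_le_zero.1 (by linarith)
  obtain ⟨ε₀, hε₀, β, hβ0, hβ, hcontr⟩ :=
    exists_dist_le_of_iterate_image_subset_ball hfc hN hρ hdouble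
  obtain ⟨r, hr, hdist⟩ := exists_forall_exists_dist_eq (M := M)
  refine ⟨ε₀, hε₀, fun ε hε hεε₀ T => ?_⟩
  have hT : T.Contracts β := T.contracts_of_image_subset_ball hfc fun m A hA p hp =>
    hcontr m A hA p (hp.trans (Metric.ball_subset_ball hεε₀.le))
  have hκ : 0 < min r (ε / 8) := lt_min hr (by positivity)
  obtain ⟨a₀, ha₀⟩ := InducedTiling.exists_forall_exists_psi_subset (ε := ε) hβ0 hβ hinj hε hκ
    (by
      intro c
      obtain ⟨w, hw⟩ := hdist _ ⟨hκ.le, min_le_left _ _⟩ c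
      refine ⟨w, ?_, hw.ge⟩
      rw [Metric.mem_ball, hw]
      exact (min_le_right _ _).trans_lt (by linarith))
  refine ⟨⟨a₀ + 1, Nat.succ_pos _, fun p hp m hm => ?_⟩, fun aStar _ Y hY => ?_⟩
  -- Dodging the empty set gives the gap property.
  · obtain ⟨q, hq, h1, h2, -⟩ := ha₀ m (by omega) T hT p hp ∅ (by simp)
    exact ⟨q, hq, h1, h2⟩
  · refine ⟨max a₀ (aStar + 1), by omega, fun b hb => ?_⟩
    exact hT.isWinningAB_nonAccumulating hfc hβ0 (by positivity : 0 < min r (ε / 8) / 4) (by omega)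
      (fun p hp Z hZ => ha₀ _ (le_max_left _ _) T hT p hp Z hZ) hY
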